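/- Let $F$ be a number field, $E$ an elliptic curve over $F$, $p$ a prime number, $v$ a finite place of $F$ and $F_v$ the completion of $F$ at $v$. Let $P_1 \in E(F_v)$ with $P_1 \notin E[2]$, i.e. $2P_1 \neq 0$. Then there exist a finite extension $K$ of $F$, a finite place $w$ of $K$ lying over $v$ such that $K_w = F_v$ (that is, the natural map $F_v \to K_w$ is an isomorphism of topological fields, by which $E(F_v)$ and $E(K_w)$ are identified), and a point $P \in E(K)$ such that $$P \equiv P_1 \pmod{p\,E(K_w)}.$$ Moreover, if all points of $E[p] = \{T \in E(\overline F) : pT = 0\}$ are defined over $F$, then $K$ can be chosen with $[K:F] \le 2$. -/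

import Mathlib

open IsDedekindDomain NumberField

open scoped Classical WeierstrassCurve.Affine

universe u

/-- `E[n] ⊆ F`: every geometric point of `E` killed by `n` is defined over the base field `F`. -/
def TorsionIsRational {F : Type u} [Field F] (E : WeierstrassCurve F) (n : ℕ) : Prop :=
  ∀ T : (E⁄(AlgebraicClosure F)).Point, n • T = 0 →
    ∃ T₀ : (E⁄F).Point, WeierstrassCurve.Affine.Point.baseChange F (AlgebraicClosure F) T₀ = T

/-- The point `P₁ ∈ E(F_v)` is approximated modulo `p` over the finite extension `K` of `F`:
there are a finite place `w` of `K` above `v` with `K_w = F_v` (an identification `σ` of topological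
`F`-algebras, which is unique because `F` is dense in `F_v`, hence is the canonical map) and a point
`P ∈ E(K)` with `P ≡ P₁` modulo `p E(K_w)`. -/
def ApproximatedOver {F : Type u} [Field F] [NumberField F] (E : WeierstrassCurve F) (p : ℕ)
    (v : HeightOneSpectrum (𝓞 F)) (P₁ : (E⁄(v.adicCompletion F)).Point)
    (K : Type u) [Field K] [NumberField K] [Algebra F K] : Prop :=
  ∃ (w : HeightOneSpectrum (𝓞 K)) (σ : v.adicCompletion F ≃A[F] w.adicCompletion K)
    (P : (E⁄K).Point) (R : (E⁄(w.adicCompletion K)).Point),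
    w.asIdeal.LiesOver v.asIdeal ∧
    WeierstrassCurve.Affine.Point.map (IsScalarTower.toAlgHom F K (w.adicCompletion K)) P
      - WeierstrassCurve.Affine.Point.map (σ : v.adicCompletion F →ₐ[F] w.adicCompletion K) P₁
      = p • R

open Topology Filter

/-! The abscissas of the points of P₁ + pE(F_v) fill a neighbourhood of x(P₁). Indeed, move a point
c(s) along the curve from T = c(s₀): since the invariant differential is translation invariant, P₁ +
p(c(s) - T) has velocity pω ≠ 0 (`IsArcAt.const_add_nsmul_sub`), and as 2P₁ ≠ 0 its abscissa has
nonzero derivative, so it is open at s₀ (`eventually_exists_add_nsmul`). By density some such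
abscissa x lies in F. Its ordinate y ∈ F_v is a root of a monic quadratic over F, so K = F(y) ⊆ F_v
has degree at most 2, and F_v is the completion of K at the place induced by this inclusion
(`exists_adicCompletion_equiv`). -/

namespace WeierstrassCurve.Affine

/-! ### Differential calculus on the curve -/

section Calculus

variable {k : Type*} [NontriviallyNormedField k] {W : WeierstrassCurve.Affine k}

/-- A family of points on `W` whose coordinates are strictly differentiable at `s₀`, with velocity
`ω` with respect to the invariant differential `dx / (2y + a₁x + a₃)`. -/
def IsArcAt (c : k → W.Point) (s₀ ω : k) : Prop :=
  ∃ X Y : k → k, (∀ᶠ s in 𝓝 s₀, ∃ h, c s = .some (X s) (Y s) h) ∧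
    HasStrictDerivAt X (ω * (2 * Y s₀ + W.a₁ * X s₀ + W.a₃)) s₀ ∧
    HasStrictDerivAt Y (ω * (3 * X s₀ ^ 2 + 2 * W.a₂ * X s₀ + W.a₄ - W.a₁ * Y s₀)) s₀

lemma isArcAt_const {P : W.Point} (hP : P ≠ 0) (s₀ : k) : IsArcAt (fun _ ↦ P) s₀ 0 := by
  rcases P with _ | ⟨x, y, h⟩
  · exact absurd rfl hP
  · refine ⟨fun _ ↦ x, fun _ ↦ y, .of_forall fun _ ↦ ⟨h, rfl⟩, ?_, ?_⟩ <;>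
      simpa using hasStrictDerivAt_const _ _

/-- The slope of the chord through two points determines `a₄` from the other coefficients. -/
lemma a₄_eq_of_chord {x₁ x₂ y₁ y₂ ℓ : k} (h₁ : W.Equation x₁ y₁) (h₂ : W.Equation x₂ y₂)
    (hx : x₁ ≠ x₂) (hℓ : y₁ = y₂ + ℓ * (x₁ - x₂)) :
    W.a₄ = ℓ * (y₁ + y₂) + W.a₁ * (y₂ + ℓ * x₁) + W.a₃ * ℓ - (x₁ ^ 2 + x₁ * x₂ + x₂ ^ 2)
      - W.a₂ * (x₁ + x₂) := by
  rw [equation_iff] at h₁ h₂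
  apply mul_left_cancel₀ (sub_ne_zero.2 hx)
  subst hℓ
  linear_combination h₂ - h₁

/-- Velocities add because the invariant differential is translation invariant. Excluding c = ±d at
s₀ leaves only the chord formula to differentiate. -/
lemma IsArcAt.add {c d : k → W.Point} {s₀ ω ω' : k} (hc : IsArcAt c s₀ ω) (hd : IsArcAt d s₀ ω')
    (hne : c s₀ ≠ d s₀) (hne' : c s₀ ≠ -d s₀) :
    IsArcAt (fun s ↦ c s + d s) s₀ (ω + ω') := by
  obtain ⟨X₁, Y₁, e₁, dX₁, dY₁⟩ := hc
  obtain ⟨X₂, Y₂, e₂, dX₂, dY₂⟩ := hd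
  obtain ⟨h₁, hc₁⟩ := e₁.self_of_nhds
  obtain ⟨h₂, hd₂⟩ := e₂.self_of_nhds
  have hx : X₁ s₀ ≠ X₂ s₀ := by
    rw [Ne, Point.X_eq_iff (h₁ := h₁) (h₂ := h₂), ← hc₁, ← hd₂]
    tauto
  have hx' := sub_ne_zero.2 hx
  set ℓ : k → k := fun s ↦ (Y₁ s - Y₂ s) / (X₁ s - X₂ s) with hℓ
  have hℓ₀ : Y₁ s₀ = Y₂ s₀ + ℓ s₀ * (X₁ s₀ - X₂ s₀) := by
    simp only [hℓ]; field_simp; ring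
  have h₄ := a₄_eq_of_chord h₁.1 h₂.1 hx hℓ₀
  -- On the chord the equation becomes (x - x₁)(x - x₂)(x - x₃) = 0. Differentiating at x₁ shows
  -- that the first arc has Y' - ℓX' = ω(x₁ - x₂)(x₁ - x₃); the second is symmetric.
  have dℓ : HasStrictDerivAt ℓ (ω * (X₁ s₀ - W.addX (X₁ s₀) (X₂ s₀) (ℓ s₀)) +
      ω' * (X₂ s₀ - W.addX (X₁ s₀) (X₂ s₀) (ℓ s₀))) s₀ := by
    refine HasStrictDerivAt.congr_deriv ((dY₁.fun_sub dY₂).fun_div (dX₁.fun_sub dX₂) hx') ?_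
    rw [div_eq_iff (pow_ne_zero 2 hx'), addX]
    rw [h₄, hℓ₀]
    ring
  have dX : HasStrictDerivAt (fun s ↦ W.addX (X₁ s) (X₂ s) (ℓ s)) ((ω + ω') *
      (2 * W.addY (X₁ s₀) (X₂ s₀) (Y₁ s₀) (ℓ s₀) + W.a₁ * W.addX (X₁ s₀) (X₂ s₀) (ℓ s₀) + W.a₃))
      s₀ := by
    refine HasStrictDerivAt.congr_deriv ((((dℓ.fun_pow 2).fun_add
      (dℓ.const_mul W.a₁)).sub_const W.a₂).fun_sub dX₁ |>.fun_sub dX₂) ?_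
    simp only [addX, addY, negAddY, negY]
    rw [hℓ₀]
    ring
  refine ⟨_, fun s ↦ W.addY (X₁ s) (X₂ s) (Y₁ s) (ℓ s), ?_, dX, ?_⟩
  · have hne_ev : ∀ᶠ s in 𝓝 s₀, X₁ s ≠ X₂ s :=
      ((HasStrictDerivAt.hasDerivAt (dX₁.fun_sub dX₂)).continuousAt.eventually_ne hx').mono
        fun _ ↦ sub_ne_zero.1
    filter_upwards [e₁, e₂, hne_ev] with s ⟨g₁, hs₁⟩ ⟨g₂, hs₂⟩ hs
    have hadd := Point.add_of_X_ne (h₁ := g₁) (h₂ := g₂) hs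
    have hsl := slope_of_X_ne (W := W) (y₁ := Y₁ s) (y₂ := Y₂ s) hs
    refine ⟨?_, ?_⟩
    · have := nonsingular_add g₁ g₂ fun hxy ↦ hs hxy.1
      rwa [hsl] at this
    · rw [hs₁, hs₂, hadd]
      simp only [hsl, hℓ]
  · refine HasStrictDerivAt.congr_deriv ((((dℓ.fun_mul (dX.fun_sub dX₁)).fun_add dY₁).fun_neg.fun_sub
      (dX.const_mul W.a₁)).sub_const W.a₃) ?_
    simp only [addX, addY, negAddY, negY]
    rw [h₄, hℓ₀]
    ring

/-- A square root that is differentiable near a nonzero point. -/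
lemma _root_.exists_hasStrictDerivAt_sqrt [CompleteSpace k] [CharZero k] {a : k} (ha : a ≠ 0) :
    ∃ S : k → k, S (a ^ 2) = a ∧ (∀ᶠ t in 𝓝 (a ^ 2), S t ^ 2 = t) ∧
      HasStrictDerivAt S (2 * a)⁻¹ (a ^ 2) := by
  have h : HasStrictDerivAt (fun t : k ↦ t ^ 2) (2 * a) a := by
    simpa using hasStrictDerivAt_pow 2 a
  have h0 : 2 * a ≠ 0 := mul_ne_zero two_ne_zero ha
  exact ⟨h.localInverse _ _ _ h0, (h.eventually_left_inverse h0).self_of_nhds,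
    h.eventually_right_inverse h0, h.to_localInverse h0⟩

/-- Away from the `2`-torsion, the abscissa is a local parameter. -/
lemma exists_hasStrictDerivAt_Y [CompleteSpace k] [CharZero k] [W.IsElliptic] {x₁ y₁ : k}
    (h : W.Equation x₁ y₁) (hy : 2 * y₁ + W.a₁ * x₁ + W.a₃ ≠ 0) :
    ∃ Y : k → k, Y x₁ = y₁ ∧ (∀ᶠ x in 𝓝 x₁, W.Equation x (Y x)) ∧
      HasStrictDerivAt Y ((2 * y₁ + W.a₁ * x₁ + W.a₃)⁻¹ *
        (3 * x₁ ^ 2 + 2 * W.a₂ * x₁ + W.a₄ - W.a₁ * y₁)) x₁ := by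
  obtain ⟨S, hS, hS', dS⟩ := exists_hasStrictDerivAt_sqrt hy
  -- The discriminant of the Weierstrass equation as a quadratic in y.
  set g : k → k := fun x ↦ (W.a₁ * x + W.a₃) ^ 2 + 4 * (x ^ 3 + W.a₂ * x ^ 2 + W.a₄ * x + W.a₆)
    with hg
  have hg₁ : g x₁ = (2 * y₁ + W.a₁ * x₁ + W.a₃) ^ 2 := by
    rw [equation_iff] at h
    simp only [hg]
    linear_combination -4 * h
  have hid := hasStrictDerivAt_id x₁
  have dg : HasStrictDerivAt g (2 * (W.a₁ * x₁ + W.a₃) * W.a₁ +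
      4 * (3 * x₁ ^ 2 + 2 * W.a₂ * x₁ + W.a₄)) x₁ := by
    refine HasStrictDerivAt.congr_deriv ((((hid.const_mul W.a₁).add_const W.a₃).fun_pow 2).fun_add
      (((((hid.fun_pow 3).fun_add ((hid.fun_pow 2).const_mul W.a₂)).fun_add
        (hid.const_mul W.a₄)).add_const W.a₆).const_mul 4)) ?_
    simp only [id]
    push_cast
    ring
  have h2 : (2 : k) ≠ 0 := two_ne_zero
  rw [← hg₁] at hS hS' dS
  refine ⟨fun x ↦ (S (g x) - (W.a₁ * x + W.a₃)) / 2, ?_, ?_, ?_⟩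
  · simp only [hS]
    field_simp
    ring
  · filter_upwards [(HasStrictDerivAt.hasDerivAt dg).continuousAt.eventually hS'] with x hx
    rw [equation_iff]
    field_simp
    linear_combination hx
  · refine HasStrictDerivAt.congr_deriv (((dS.comp x₁ dg).fun_sub
      ((hid.const_mul W.a₁).add_const W.a₃)).div_const 2) ?_
    field_simp
    ring

lemma Point.two_nsmul_some_eq_zero_iff {x y : k} (h : W.Nonsingular x y) :
    2 • Point.some x y h = 0 ↔ 2 * y + W.a₁ * x + W.a₃ = 0 := by
  rw [two_nsmul]
  constructor
  · intro h0
    by_contra hy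
    refine Point.some_ne_zero _ ((Point.add_self_of_Y_ne (h₁ := h) fun hy' ↦ hy ?_).symm.trans h0)
    rw [negY] at hy'
    linear_combination hy'
  · intro hy
    refine Point.add_self_of_Y_eq ?_
    rw [negY]
    linear_combination hy

/-- The abscissa serves as parameter, so nearby points differ from ±P because their abscissas differ
from that of P. -/
lemma exists_isArcAt [CompleteSpace k] [CharZero k] [W.IsElliptic] {P : W.Point}
    (hP : 2 • P ≠ 0) : ∃ (c : k → W.Point) (s₀ ω : k), ω ≠ 0 ∧ IsArcAt c s₀ ω ∧ c s₀ = P ∧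
      (∀ᶠ s in 𝓝[≠] s₀, 2 • c s ≠ 0 ∧ c s ≠ P ∧ c s ≠ -P) := by
  rcases P with _ | ⟨x₁, y₁, h₁⟩
  · exact absurd (smul_zero 2) hP
  have hy := (Point.two_nsmul_some_eq_zero_iff h₁).not.1 hP
  obtain ⟨Y, rfl, hY, dY⟩ := exists_hasStrictDerivAt_Y h₁.1 hy
  have hc (s : k) (hs : W.Equation s (Y s)) :
      (if hs : W.Equation s (Y s) then Point.mk hs else 0) =
        Point.some s (Y s) (equation_iff_nonsingular.1 hs) := by
    rw [dif_pos hs, Point.mk]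
  refine ⟨fun s ↦ if hs : W.Equation s (Y s) then .mk hs else 0, x₁, _, inv_ne_zero hy,
    ⟨id, Y, ?_, ?_, dY⟩, hc x₁ h₁.1, ?_⟩
  · filter_upwards [hY] with s hs
    exact ⟨equation_iff_nonsingular.1 hs, hc s hs⟩
  · exact (hasStrictDerivAt_id x₁).congr_deriv (inv_mul_cancel₀ hy).symm
  · have dψ := ((dY.const_mul 2).fun_add ((hasStrictDerivAt_id x₁).const_mul W.a₁)).add_const W.a₃
    have hψ := (HasStrictDerivAt.hasDerivAt dψ).continuousAt.eventually_ne hy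
    filter_upwards [hY.filter_mono nhdsWithin_le_nhds, hψ.filter_mono nhdsWithin_le_nhds,
      self_mem_nhdsWithin] with s hs hs' hne
    rw [hc s hs]
    refine ⟨(Point.two_nsmul_some_eq_zero_iff _).not.2 hs', ?_⟩
    rw [← not_or, ← Point.X_eq_iff]
    exact hne

/-- Adding c(s) and then -c(s₀), instead of the small difference, keeps all sums away from the point
at infinity. At s₀ the sums are P + T and (P + T) - T, with T = c(s₀); the hypotheses make both of
them chord additions. -/
lemma IsArcAt.const_add_nsmul_sub {c : k → W.Point} {s₀ ω : k} (hc : IsArcAt c s₀ ω)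
    {P : W.Point} (hP : P ≠ 0) (h0 : c s₀ ≠ 0) (hne : c s₀ ≠ P) (hne' : c s₀ ≠ -P)
    (h2 : 2 • c s₀ ≠ -P) (n : ℕ) :
    IsArcAt (fun s ↦ P + n • (c s - c s₀)) s₀ (n * ω) := by
  induction n with
  | zero => simpa using isArcAt_const hP s₀
  | succ n ih =>
    have h₁ := ih.add hc (by simpa using hne.symm)
      (by simpa using fun h ↦ hne' (neg_eq_iff_eq_neg.1 h.symm))
    have h₂ := h₁.add (isArcAt_const (neg_ne_zero.2 h0) s₀)
      (by simpa using fun h ↦ h2 (by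
        rw [two_nsmul, ← sub_eq_zero, ← sub_eq_zero.2 h]; abel))
      (by simpa using hP)
    convert h₂ using 1
    · funext s
      rw [succ_nsmul]
      abel
    · push_cast
      ring

/-- Translates of a point of order different from `1` and `2` by multiples of `n` take all
abscissas in a neighbourhood. -/
lemma eventually_exists_add_nsmul [CompleteSpace k] [CharZero k] [W.IsElliptic] {x₁ y₁ : k}
    (h₁ : W.Nonsingular x₁ y₁) (hP : 2 • Point.some x₁ y₁ h₁ ≠ 0) {n : ℕ} (hn : n ≠ 0) :
    ∀ᶠ x in 𝓝 x₁, ∃ y h, ∃ R : W.Point, Point.some x₁ y₁ h₁ + n • R = .some x y h := by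
  set P : W.Point := .some x₁ y₁ h₁ with hPdef
  obtain ⟨T, hT2, hTP, hTP', hT⟩ :
      ∃ T : W.Point, 2 • T ≠ 0 ∧ T ≠ P ∧ T ≠ -P ∧ 2 • T ≠ -P := by
    obtain ⟨c, s₀, ω, -, -, -, hc⟩ := exists_isArcAt hP
    obtain ⟨s, hs2, hsP, hsP'⟩ := hc.exists
    by_cases h : 2 • c s = -P
    -- If 2T = -P, then -T works: 2(-T) = P ≠ -P because 2P ≠ 0.
    · refine ⟨-c s, by rwa [smul_neg, neg_ne_zero], fun h' ↦ hsP' (neg_eq_iff_eq_neg.1 h'),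
        fun h' ↦ hsP (neg_injective h'), fun h' ↦ hP ?_⟩
      rw [smul_neg, h, neg_neg] at h'
      rw [two_nsmul]
      exact eq_neg_iff_add_eq_zero.1 h'
    · exact ⟨c s, hs2, hsP, hsP', h⟩
  obtain ⟨c, s₀, ω, hω, hc, rfl, -⟩ := exists_isArcAt hT2
  have h0 {Q : W.Point} (hQ : 2 • Q ≠ 0) : Q ≠ 0 := fun h ↦ hQ (by rw [h, smul_zero])
  obtain ⟨X, Y, e, dX, -⟩ := hc.const_add_nsmul_sub (h0 hP) (h0 hT2) hTP hTP' hT n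
  obtain ⟨h, hs₀⟩ := e.self_of_nhds
  simp only [sub_self, smul_zero, add_zero, hPdef, Point.some.injEq] at hs₀
  rw [← hs₀.1, ← hs₀.2] at dX
  have hX : Filter.map X (𝓝 s₀) = 𝓝 (X s₀) := HasStrictDerivAt.map_nhds_eq dX <|
    mul_ne_zero (mul_ne_zero (Nat.cast_ne_zero.2 hn) hω)
      ((Point.two_nsmul_some_eq_zero_iff h₁).not.1 hP)
  rw [hs₀.1, ← hX, eventually_map]
  exact e.mono fun s ⟨h, hs⟩ ↦ ⟨_, h, _, hs⟩

end Calculus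

end WeierstrassCurve.Affine

/-! ### Comparison of completions -/

/-- Two complete rings containing `K` as a dense subring on which they induce the same topology are
isomorphic over `K`. -/
lemma exists_continuous_ringEquiv {K A B : Type*} [CommRing K]
    [CommRing A] [UniformSpace A] [IsUniformAddGroup A] [IsTopologicalRing A] [T2Space A]
    [CompleteSpace A] [CommRing B] [UniformSpace B] [IsUniformAddGroup B] [IsTopologicalRing B]
    [T2Space B] [CompleteSpace B] {f : K →+* A} {g : K →+* B} (hf : DenseRange f)
    (hg : DenseRange g) (h : comap f (𝓝 0) = comap g (𝓝 0)) :
    ∃ σ : A ≃+* B, Continuous σ ∧ Continuous σ.symm ∧ ∀ x, σ (f x) = g x := by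
  let := UniformSpace.comap f inferInstance
  have hfi : IsUniformInducing f := ⟨rfl⟩
  have : IsUniformAddGroup K := IsUniformAddGroup.comap f
  have hgi : IsUniformInducing g := by
    have hg' : @IsUniformAddGroup K (UniformSpace.comap g inferInstance) _ :=
      IsUniformAddGroup.comap g
    -- The neighbourhoods of 0 determine the uniformity of a topological group, so f and g induce
    -- the same one.
    refine isUniformInducing_iff_uniformSpace.2 (IsUniformAddGroup.ext hg' inferInstance ?_)
    rw [nhds_induced, hfi.isInducing.nhds_eq_comap, map_zero, map_zero, h]
  let σ := IsDenseInducing.extendRingHom hfi hf hgi.uniformContinuous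
  let τ := IsDenseInducing.extendRingHom hgi hg hfi.uniformContinuous
  have cσ : Continuous σ := (uniformContinuous_uniformly_extend hfi hf hgi.uniformContinuous).continuous
  have cτ : Continuous τ := (uniformContinuous_uniformly_extend hgi hg hfi.uniformContinuous).continuous
  have hσ (x : K) : σ (f x) = g x := uniformly_extend_of_ind hfi hf hgi.uniformContinuous x
  have hτ (x : K) : τ (g x) = f x := uniformly_extend_of_ind hgi hg hfi.uniformContinuous x
  refine ⟨.ofRingHom σ τ ?_ ?_, cσ, cτ, hσ⟩
  · exact RingHom.ext <| congr_fun <| hg.equalizer (cσ.comp cτ) continuous_id <|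
      funext fun x ↦ by simp [hσ, hτ]
  · exact RingHom.ext <| congr_fun <| hf.equalizer (cτ.comp cσ) continuous_id <|
      funext fun x ↦ by simp [hσ, hτ]

lemma comap_nhds_zero_le_of_norm_eq_rpow {K A B : Type*} [SeminormedAddCommGroup A]
    [SeminormedAddCommGroup B] {f : K → A} {g : K → B} {c : ℝ} (hc : 0 < c)
    (h : ∀ x, ‖g x‖ = ‖f x‖ ^ c) : comap f (𝓝 0) ≤ comap g (𝓝 0) := by
  rw [← tendsto_iff_comap, tendsto_zero_iff_norm_tendsto_zero]
  simp only [h]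
  have h0 : Tendsto (fun x ↦ ‖f x‖) (comap f (𝓝 0)) (𝓝 0) :=
    tendsto_zero_iff_norm_tendsto_zero.1 tendsto_comap
  simpa [Real.zero_rpow hc.ne'] using h0.rpow_const (Or.inr hc.le)

/-! ### The place attached to an embedding into F_v -/

namespace NumberField

open HeightOneSpectrum FinitePlace

variable {F : Type u} [Field F] [NumberField F] (v : HeightOneSpectrum (𝓞 F))

instance : CharZero (v.adicCompletion F) :=
  charZero_of_injective_algebraMap (algebraMap F (v.adicCompletion F)).injective

variable {K : Type u} [Field K] [NumberField K] [Algebra F K]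

-- Elements of 𝓞 K are integral over ℤ, and a valuation ring is integrally closed.
omit [NumberField K] [Algebra F K] in
variable {v} in
lemma norm_map_ringOfIntegers_le_one (i : K →+* v.adicCompletion F) (a : 𝓞 K) : ‖i a‖ ≤ 1 := by
  rw [Valued.toNormedField.norm_le_one_iff]
  refine (HeightOneSpectrum.adicCompletionIntegers.integers F v).mem_of_integral ?_
  obtain ⟨q, hq, hq₀⟩ := RingOfIntegers.isIntegral_coe a
  refine ⟨q.map (Int.castRingHom _), hq.map _, ?_⟩
  rw [Polynomial.eval₂_map]
  have h := congrArg i hq₀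
  rw [Polynomial.hom_eval₂, map_zero] at h
  rwa [RingHom.ext_int (i.comp (algebraMap ℤ K))
    ((algebraMap (v.adicCompletionIntegers F) (v.adicCompletion F)).comp (Int.castRingHom _))] at h

variable {v} in
lemma algebraMap_norm_lt_one_iff (a : 𝓞 F) :
    ‖algebraMap F (v.adicCompletion F) a‖ < 1 ↔ a ∈ v.asIdeal :=
  norm_lt_one_iff_mem F v a

/-- The place of `K` defined by an embedding of `K` into a completion of `F`. -/
noncomputable def placeOfEmbedding (i : K →ₐ[F] v.adicCompletion F) : HeightOneSpectrum (𝓞 K) where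
  asIdeal :=
    { carrier := {a | ‖i a‖ < 1}
      zero_mem' := by simp
      add_mem' := by
        intro a b ha hb
        simp only [Set.mem_ofPred_eq, map_add] at ha hb ⊢
        exact (IsUltrametricDist.norm_add_le_max _ _).trans_lt (max_lt ha hb)
      smul_mem' := by
        intro a b hb
        simp only [Set.mem_ofPred_eq, smul_eq_mul, map_mul, norm_mul] at hb ⊢
        exact mul_lt_one_of_nonneg_of_lt_one_right
          (norm_map_ringOfIntegers_le_one (i : K →+* v.adicCompletion F) a) (norm_nonneg _) hb }
  isPrime := by
    refine ⟨fun h ↦ ?_, fun {a b} h ↦ ?_⟩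
    · simpa using (Ideal.eq_top_iff_one _).1 h
    · by_contra! hab
      have ha : 1 ≤ ‖i a‖ := not_lt.1 hab.1
      have hb : 1 ≤ ‖i b‖ := not_lt.1 hab.2
      have h' : ‖i (a * b)‖ < 1 := h
      rw [map_mul, norm_mul] at h'
      exact h'.not_ge (one_le_mul_of_one_le_of_one_le ha hb)
  ne_bot := by
    obtain ⟨a, ha, ha₀⟩ := Submodule.exists_mem_ne_zero_of_ne_bot v.ne_bot
    refine (Submodule.ne_bot_iff _).2 ⟨algebraMap (𝓞 F) (𝓞 K) a, ?_, ?_⟩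
    · change ‖i (algebraMap F K a)‖ < 1
      rw [i.commutes]
      exact (algebraMap_norm_lt_one_iff a).2 ha
    · exact (map_ne_zero_iff _ (FaithfulSMul.algebraMap_injective _ _)).2 ha₀

variable {v} in
lemma mem_placeOfEmbedding {i : K →ₐ[F] v.adicCompletion F} {a : 𝓞 K} :
    a ∈ (placeOfEmbedding v i).asIdeal ↔ ‖i a‖ < 1 := Iff.rfl

/-- Absolute values are powers of each other once one open unit ball lies in the other and the first
is nontrivial. The value of the exponent does not affect the topology. -/
lemma exists_norm_algebraMap_eq_rpow (i : K →ₐ[F] v.adicCompletion F) :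
    ∃ c : ℝ, 0 < c ∧ ∀ x,
      ‖i x‖ = ‖algebraMap K ((placeOfEmbedding v i).adicCompletion K) x‖ ^ c := by
  set w := placeOfEmbedding v i
  let f : AbsoluteValue K ℝ := (NormedField.toAbsoluteValue _).comp (algebraMap K (w.adicCompletion K)).injective
  let g : AbsoluteValue K ℝ := (NormedField.toAbsoluteValue _).comp (i : K →+* v.adicCompletion F).injective
  have hfg : f.IsEquiv g := by
    apply AbsoluteValue.isEquiv_of_lt_one_imp
    · obtain ⟨a, ha, ha₀⟩ := Submodule.exists_mem_ne_zero_of_ne_bot w.ne_bot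
      exact ⟨a, by simpa using ha₀, ((algebraMap_norm_lt_one_iff a).2 ha).ne⟩
    · intro x hx
      have hx' : w.valuation K x < 1 := by
        rw [← HeightOneSpectrum.valuedAdicCompletion_eq_valuation']
        exact Valued.toNormedField.norm_lt_one_iff.1 hx
      -- Write x = n/d with d outside w: then d has norm 1 in F_v, and n lies in w, so has norm less
      -- than 1 there.
      obtain ⟨n, d, hnd⟩ := w.exists_primeCompl_mul_eq_of_integer x hx'.le
      have hd : ‖i (d : 𝓞 K)‖ = 1 :=
        le_antisymm (norm_map_ringOfIntegers_le_one (i : K →+* v.adicCompletion F) d)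
          (not_lt.1 d.2)
      have hn : ‖i n‖ < 1 := by
        refine mem_placeOfEmbedding.1 ((w.valuation_lt_one_iff_mem (K := K) n).1 ?_)
        have hd' : w.valuation K (algebraMap (𝓞 K) K d) = 1 :=
          w.valuation_eq_one_iff_notMem.2 d.2
        change w.valuation K (algebraMap (𝓞 K) K n) < 1
        rwa [← hnd, map_mul, hd', mul_one]
      change ‖i x‖ < 1
      have h := congrArg (fun z ↦ ‖i z‖) hnd
      simp only [map_mul, norm_mul] at h
      rw [hd, mul_one] at h
      exact h.trans_lt hn
  obtain ⟨c, hc, h⟩ := AbsoluteValue.isEquiv_iff_exists_rpow_eq.1 hfg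
  exact ⟨c, hc, fun x ↦ (congr_fun h x).symm⟩

/-- The image of K contains that of F, hence is dense in F_v. So F_v and K_w both complete K for the
same topology. -/
theorem exists_adicCompletion_equiv (i : K →ₐ[F] v.adicCompletion F) :
    ∃ (w : HeightOneSpectrum (𝓞 K)) (σ : v.adicCompletion F ≃A[F] w.adicCompletion K),
      w.asIdeal.LiesOver v.asIdeal ∧ ∀ x, σ (i x) = algebraMap K (w.adicCompletion K) x := by
  refine ⟨placeOfEmbedding v i, ?_⟩
  obtain ⟨c, hc, h⟩ := exists_norm_algebraMap_eq_rpow v i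
  have hi : DenseRange i := by
    refine (HeightOneSpectrum.denseRange_algebraMap F v).mono ?_
    rintro _ ⟨x, rfl⟩
    exact ⟨algebraMap F K x, i.commutes x⟩
  obtain ⟨σ, hσ, hσ', hσi⟩ := exists_continuous_ringEquiv (f := (i : K →+* v.adicCompletion F)) hi
    (HeightOneSpectrum.denseRange_algebraMap K (placeOfEmbedding v i)) <| by
      apply le_antisymm
      · refine comap_nhds_zero_le_of_norm_eq_rpow (inv_pos.2 hc) fun x ↦ ?_
        exact (Real.eq_rpow_inv (norm_nonneg _) (norm_nonneg _) hc.ne').2 (h x).symm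
      · exact comap_nhds_zero_le_of_norm_eq_rpow hc h
  refine ⟨{ AlgEquiv.ofRingEquiv (f := σ) fun x ↦ ?_ with
    continuous_toFun := hσ
    continuous_invFun := hσ' }, ⟨?_⟩, hσi⟩
  · rw [← i.commutes x]
    exact (hσi _).trans (IsScalarTower.algebraMap_apply F K _ x).symm
  · ext a
    rw [Ideal.mem_comap, mem_placeOfEmbedding, ← algebraMap_norm_lt_one_iff, ← i.commutes]
    rfl

end NumberField

/-! ### Descent to a quadratic extension -/

open Polynomial in
/-- A point with abscissa in the base field is defined over an extension of degree at most `2`. -/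
lemma WeierstrassCurve.Affine.finrank_adjoin_Y_le_two {F L : Type*} [Field F] [Field L] [Algebra F L]
    (E : WeierstrassCurve F) {x : F} {y : L} (h : (E⁄L).Equation (algebraMap F L x) y) :
    FiniteDimensional F (IntermediateField.adjoin F {y}) ∧
      Module.finrank F (IntermediateField.adjoin F {y}) ≤ 2 := by
  let q : F[X] := X ^ 2 + C (E.a₁ * x + E.a₃) * X - C (x ^ 3 + E.a₂ * x ^ 2 + E.a₄ * x + E.a₆)
  have hq₂ : q.natDegree = 2 := by simp only [q]; compute_degree!
  have hq : q.Monic := by simp only [q]; monicity!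
  have hq₀ : aeval y q = 0 := by
    rw [equation_iff] at h
    simp only [baseChange, WeierstrassCurve.baseChange, map_a₁, map_a₂, map_a₃, map_a₄, map_a₆] at h
    simp only [q, map_sub, map_add, map_mul, map_pow, aeval_X, aeval_C]
    linear_combination h
  have hy : _root_.IsIntegral F y := ⟨q, hq, hq₀⟩
  refine ⟨IntermediateField.adjoin.finiteDimensional hy, ?_⟩
  rw [IntermediateField.adjoin.finrank hy, ← hq₂]
  exact natDegree_le_of_dvd (minpoly.dvd F y hq₀) hq.ne_zero

theorem exists_approximatedOver_finrank_le_two {F : Type u} [Field F] [NumberField F]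
    (E : WeierstrassCurve F) [E.IsElliptic] {n : ℕ} (hn : n ≠ 0)
    (v : HeightOneSpectrum (𝓞 F)) (P₁ : (E⁄(v.adicCompletion F)).Point) (hP₁ : 2 • P₁ ≠ 0) :
    ∃ (K : Type u) (_ : Field K) (_ : NumberField K) (_ : Algebra F K),
      FiniteDimensional F K ∧ Module.finrank F K ≤ 2 ∧ ApproximatedOver E n v P₁ K := by
  obtain _ | ⟨x₁, y₁, h₁⟩ := P₁
  · exact absurd (smul_zero 2) hP₁
  let _ : NontriviallyNormedField (v.adicCompletion F) :=
    Valued.toNontriviallyNormedField (L := v.adicCompletion F) (Γ₀ := WithZero (Multiplicative ℤ))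
  have : (E⁄(v.adicCompletion F)).IsElliptic :=
    inferInstanceAs (E.map (algebraMap F (v.adicCompletion F))).IsElliptic
  obtain ⟨x, y, h, R, hR⟩ := (v.denseRange_algebraMap F).exists_mem_open
    isOpen_interior ⟨x₁, mem_interior_iff_mem_nhds.2
      (WeierstrassCurve.Affine.eventually_exists_add_nsmul h₁ hP₁ hn)⟩ |>.imp
        fun x hx ↦ interior_subset hx
  obtain ⟨hK, hK₂⟩ := WeierstrassCurve.Affine.finrank_adjoin_Y_le_two E h.1
  -- Taken inside F_v, so that the inclusion is the embedding that defines w.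
  let K := IntermediateField.adjoin F {y}
  have : FiniteDimensional F K := hK
  have : NumberField K := .of_module_finite F K
  obtain ⟨w, σ, hw, hσ⟩ := NumberField.exists_adicCompletion_equiv v K.val
  let yK : K := ⟨y, IntermediateField.mem_adjoin_simple_self F y⟩
  have hP : (E⁄K).Nonsingular (algebraMap F K x) yK :=
    (WeierstrassCurve.Affine.baseChange_nonsingular E K.val.injective _ _).1 h
  refine ⟨K, inferInstance, this, inferInstance, hK, hK₂, w, σ, .some _ _ hP,
    WeierstrassCurve.Affine.Point.map (σ : v.adicCompletion F →ₐ[F] w.adicCompletion K) R, hw, ?_⟩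
  rw [sub_eq_iff_eq_add', ← map_nsmul, ← map_add, hR]
  simp only [WeierstrassCurve.Affine.Point.map_some, WeierstrassCurve.Affine.Point.some.injEq]
  exact ⟨(hσ (algebraMap F K x)).symm, (hσ yK).symm⟩

theorem proposition3p2p1 {F : Type u} [Field F] [NumberField F]
    (E : WeierstrassCurve F) [E.IsElliptic] (p : ℕ) (hp : p.Prime)
    (v : HeightOneSpectrum (𝓞 F)) (P₁ : (E⁄(v.adicCompletion F)).Point)
    (hP₁ : 2 • P₁ ≠ 0) :
    (∃ (K : Type u) (_ : Field K) (_ : NumberField K) (_ : Algebra F K),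
      FiniteDimensional F K ∧ ApproximatedOver E p v P₁ K) ∧
    (TorsionIsRational E p →
      ∃ (K : Type u) (_ : Field K) (_ : NumberField K) (_ : Algebra F K),
        FiniteDimensional F K ∧ Module.finrank F K ≤ 2 ∧ ApproximatedOver E p v P₁ K) := by
  have h := exists_approximatedOver_finrank_le_two E hp.ne_zero v P₁ hP₁
  refine ⟨?_, fun _ ↦ h⟩
  obtain ⟨K, hF, hN, hA, hfin, -, hK⟩ := h
  exact ⟨K, hF, hN, hA, hfin, hK⟩
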